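/- Let $K$ be a number field with ring of integers $\mathcal O_K$ and a fixed algebraic closure $\overline K$, and let $\varphi\in\mathcal O_K[x]$ be a polynomial of degree $d>1$ with leading coefficient $a$. Write $\varphi^{\circ n}$ for its $n$-fold iterate ($\varphi^{\circ 0}(x)=x$), and let $\mathcal P_\varphi=\{\varphi^{\circ n}(r): n\ge 0,\ r\in\overline K,\ \varphi'(r)=0\}$ be its post-critical set. Assume that $\varphi$ is post-critically finite, i.e. every critical point $r\in\overline K$ of $\varphi$ is preperiodic, and let $t_0\in K\setminus\mathcal P_\varphi$. Let $F=K(t)$ be the rational function field, $\overline F$ an algebraic closure, $\mathscr F_\varphi\subset\overline F$ the field generated over $F$ by all roots of the polynomials $\varphi^{\circ n}(x)-t$, $n\ge 0$, and $\mathcal O_{\mathscr F_\varphi}$ the integral closure of $K[t]$ in $\mathscr F_\varphi$. Let $\sigma:\mathcal O_{\mathscr F_\varphi}\to\overline K$ be any global specialization at $t_0$, i.e. a $K$-algebra homomorphism with $\sigma(t)=t_0$ (such homomorphisms exist). Let $\mathscr K_{\varphi,t_0}=\sigma(\mathcal O_{\mathscr F_\varphi})$, a subfield of $\overline K$ containing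 $K$. Let $S=S_{\varphi,t_0}$ be the set of places of $K$ consisting of all real places and of those finite places $v$ for which at least one of the elements $d$, $a$, $t_0-\nu$ ($\nu\in\mathcal P_\varphi$) has nonzero (additive) valuation for some extension of $v$ to $\overline K$. Let $K_S\subset\overline K$ be the compositum of all extensions of $K$ in $\overline K$ that are unramified outside $S$, and $G_{K,S}=\mathrm{Gal}(K_S/K)$. Then $S$ is finite, the extensions $K_S/K$ and $\mathscr K_{\varphi,t_0}/K$ are Galois, and $\mathscr K_{\varphi,t_0}\subseteq K_S$. With $\mathscr M_{\varphi,t_0}=\mathrm{Gal}(\mathscr K_{\varphi,t_0}/K)$, the action of $\mathrm{Gal}(\overline K/K)$ on $\mathscr K_{\varphi,t_0}$ induces a surjection of $G_{K,S}$ onto $\mathscr M_{\varphi,t_0}$: there is a unique continuous surjective homomorphism $$\rho_{\varphi,t_0}: G_{K,S}\twoheadrightarrow \mathscr M_{\varphi,t_0}$$ such that $\rho_{\varphi,t_0}(g|_{K_S})=g|_{\mathscr K_{\varphi,t_0}}$ for all $g\in\mathrm{Gal}(\overline K/K)$. It is called the iterated monodromy representation attached to $\varphi$ and $t_0$. -/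

import Mathlib

open Polynomial NumberField IsDedekindDomain

noncomputable section

namespace IteratedMonodromy

/-! ### Dynamics of a polynomial -/

section Dynamics

variable {k L : Type*} [Field k] [Field L]

/-- `z` is preperiodic for the self-map `f` if some iterate of `f` sends `z` to a periodic point. -/
def IsPreperiodic {X : Type*} (f : X → X) (z : X) : Prop :=
  ∃ m : ℕ, f^[m] z ∈ Function.periodicPts f

/-- The critical points in `L` of a polynomial with coefficients in `L`. -/
def criticalPoints (f : L[X]) : Set L := {r | (derivative f).eval r = 0}

/-- Every critical point is preperiodic (used with `L` algebraically closed). -/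
def IsPostCriticallyFinite (f : L[X]) : Prop :=
  ∀ r ∈ criticalPoints f, IsPreperiodic (fun z => f.eval z) r

/-- The post-critical set: the union of the (full) orbits of the critical points. -/
def postCriticalSet (f : L[X]) : Set L :=
  {ν | ∃ r ∈ criticalPoints f, ∃ n : ℕ, ν = (fun z => f.eval z)^[n] r}

/-- The `n`-fold iterate of `f` under composition, with `0`-fold iterate `X`. -/
def iter (f : k[X]) (n : ℕ) : k[X] := f.comp^[n] X

end Dynamics

/-! ### The iterated extension of the function field `F = K(t)` -/

section FunctionField

variable {K : Type*} [Field K]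

/-- `Φ_n(x, t) = φ^{∘ n}(x) - t`, a polynomial in `x` over `F = K(t)`. -/
def Phi (f : K[X]) (n : ℕ) : (RatFunc K)[X] :=
  (iter f n).map (algebraMap K (RatFunc K)) - C RatFunc.X

/-- The field generated over `F = K(t)` by the roots of all the `Φ_n(x, t)`, inside a
fixed algebraic closure of `F`. -/
def iteratedField (f : K[X]) : IntermediateField (RatFunc K) (AlgebraicClosure (RatFunc K)) :=
  IntermediateField.adjoin (RatFunc K)
    (⋃ n : ℕ, (Phi f n).rootSet (AlgebraicClosure (RatFunc K)))

/-- The integral closure of `K[t]` in the iterated extension. -/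
abbrev iteratedIntegers (f : K[X]) : Subalgebra K[X] (iteratedField f) :=
  integralClosure K[X] (iteratedField f)

/-- A global specialization associated with `t₀`: a ring homomorphism from the integral closure of
`K[t]` in the iterated extension to the algebraic closure of `K` which restricts to evaluation at
`t₀` on `K[t]` (that is, a `K`-algebra homomorphism with `t ↦ t₀`). Its kernel is a prime above
`(t - t₀)`, and it embeds the residue field over `K` in the algebraic closure of `K`. -/
structure GlobalSpecialization (f : K[X]) (t₀ : K) where
  toRingHom : iteratedIntegers f →+* AlgebraicClosure K
  map_polynomial : ∀ p : K[X], toRingHom (algebraMap K[X] (iteratedIntegers f) p) =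
    algebraMap K (AlgebraicClosure K) (p.eval t₀)

/-- The specialized field: the image of a global specialization. The image is a `K`-subalgebra of
an algebraic extension of `K`, hence a field. -/
def GlobalSpecialization.field {f : K[X]} {t₀ : K} (σ : GlobalSpecialization f t₀) :
    IntermediateField K (AlgebraicClosure K) :=
  subalgebraEquivIntermediateField
    { σ.toRingHom.range with
      algebraMap_mem' := fun a => ⟨algebraMap K[X] (iteratedIntegers f) (C a), by
        rw [σ.map_polynomial, eval_C]⟩ }

theorem GlobalSpecialization.mem_field {f : K[X]} {t₀ : K} (σ : GlobalSpecialization f t₀)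
    (x : AlgebraicClosure K) : x ∈ σ.field ↔ ∃ y, σ.toRingHom y = x :=
  Iff.rfl

end FunctionField

/-! ### Places and restricted ramification -/

section Places

variable (K : Type*) [Field K] [NumberField K]

/-- The places of a number field: finite ones (maximal ideals) and infinite ones. -/
abbrev Place := HeightOneSpectrum (𝓞 K) ⊕ InfinitePlace K

variable {K}

/-- A place of `K` is unramified in an algebraic extension `L` of `K`. For a finite place and
infinite `L` this means being unramified in all finite subextensions. -/
def IsUnramifiedAtPlace (L : IntermediateField K (AlgebraicClosure K)) : Place K → Prop
  | .inl v => ∀ E : IntermediateField K (AlgebraicClosure K), E ≤ L → FiniteDimensional K E →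
      Algebra.IsUnramifiedIn (𝓞 E) v.asIdeal
  | .inr w => w.IsUnramifiedIn L

/-- `K_S`: the compositum of all the extensions of `K`, inside a fixed algebraic closure, which are
unramified outside `S`. -/
def maxUnramifiedOutside (S : Set (Place K)) : IntermediateField K (AlgebraicClosure K) :=
  sSup {L | ∀ v ∉ S, IsUnramifiedAtPlace L v}

/-- The valuation ring `A` of the algebraic closure of `K` extends the finite place `v`. -/
def ExtendsPlace (v : HeightOneSpectrum (𝓞 K)) (A : ValuationSubring (AlgebraicClosure K)) : Prop :=
  A.comap (algebraMap K (AlgebraicClosure K)) = (v.valuation K).valuationSubring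

/-- The finite place `v` does not vanish on `α`, i.e. some extension of `v` to the algebraic closure
takes at `α` a value other than that of a unit (multiplicatively, a value `≠ 1`). -/
def NonvanishingOn (v : HeightOneSpectrum (𝓞 K)) (α : AlgebraicClosure K) : Prop :=
  ∃ A : ValuationSubring (AlgebraicClosure K), ExtendsPlace v A ∧ A.valuation α ≠ 1

/-- The polynomial `φ`, with coefficients regarded in the algebraic closure of `K`. -/
abbrev geometric (φ : (𝓞 K)[X]) : (AlgebraicClosure K)[X] :=
  (φ.map (algebraMap (𝓞 K) K)).map (algebraMap K (AlgebraicClosure K))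

/-- The set `S_{φ, t₀}`: the real places, and the finite places which do not vanish on at least one
of the degree of `φ`, its leading coefficient, and `t₀ - ν` for `ν` in the post-critical set. -/
def ramificationSet (φ : (𝓞 K)[X]) (t₀ : K) : Set (Place K)
  | .inl v => NonvanishingOn v (φ.natDegree : AlgebraicClosure K) ∨
      NonvanishingOn v (geometric φ).leadingCoeff ∨
      ∃ ν ∈ postCriticalSet (geometric φ),
        NonvanishingOn v (algebraMap K (AlgebraicClosure K) t₀ - ν)
  | .inr w => w.IsReal

end Places

/-! ### Global specializations exist -/

section Existence

variable {K : Type*} [Field K]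

theorem nonempty_algHom_algebraicClosure (K L : Type*) [Field K] [Field L] [Algebra K L]
    [Algebra.IsAlgebraic K L] : Nonempty (L →ₐ[K] AlgebraicClosure K) :=
  ⟨IsAlgClosed.lift⟩

theorem nonempty_globalSpecialization (f : K[X]) (t₀ : K) :
    Nonempty (GlobalSpecialization f t₀) := by
  let P : Ideal K[X] := RingHom.ker (Polynomial.evalRingHom t₀)
  have hP : P.IsMaximal := RingHom.ker_isMaximal_of_surjective _ (fun a => ⟨C a, by simp⟩)
  have hinj : Function.Injective (algebraMap K[X] (iteratedIntegers f)) := by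
    have h : Function.Injective (algebraMap K[X] (AlgebraicClosure (RatFunc K))) := by
      rw [IsScalarTower.algebraMap_eq K[X] (RatFunc K) (AlgebraicClosure (RatFunc K))]
      exact (algebraMap (RatFunc K) _).injective.comp (RatFunc.algebraMap_injective K)
    intro p q hpq
    apply h
    exact congrArg (fun z : iteratedIntegers f =>
      ((z : iteratedField f) : AlgebraicClosure (RatFunc K))) hpq
  obtain ⟨Q, hQ, hQP⟩ := Ideal.exists_ideal_over_maximal_of_isIntegral (S := iteratedIntegers f) P
    (by rw [(RingHom.injective_iff_ker_eq_bot _).1 hinj]; exact bot_le)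
  let _ : Field (iteratedIntegers f ⧸ Q) := Ideal.Quotient.field Q
  let ψ : K →+* iteratedIntegers f ⧸ Q :=
    (Ideal.Quotient.mk Q).comp ((algebraMap K[X] (iteratedIntegers f)).comp C)
  let _ : Algebra K (iteratedIntegers f ⧸ Q) := ψ.toAlgebra
  have key : ∀ p : K[X], Ideal.Quotient.mk Q (algebraMap K[X] (iteratedIntegers f) p)
      = algebraMap K (iteratedIntegers f ⧸ Q) (p.eval t₀) := by
    intro p
    have h : p - C (p.eval t₀) ∈ P := by
      rw [RingHom.mem_ker]
      simp
    rw [← hQP, Ideal.mem_comap, map_sub, ← Ideal.Quotient.eq] at h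
    rw [h]
    rfl
  have halg : Algebra.IsAlgebraic K (iteratedIntegers f ⧸ Q) := by
    refine ⟨fun y => ?_⟩
    obtain ⟨y, rfl⟩ := Ideal.Quotient.mk_surjective y
    obtain ⟨p, hp, hy⟩ := Algebra.IsIntegral.isIntegral (R := K[X]) y
    refine IsIntegral.isAlgebraic ⟨p.map (Polynomial.evalRingHom t₀), hp.map _, ?_⟩
    have h2 := congrArg (Ideal.Quotient.mk Q) hy
    rw [map_zero, Polynomial.hom_eval₂] at h2
    rw [Polynomial.eval₂_map, ← h2]
    congr 1
    exact RingHom.ext fun p => (key p).symm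
  obtain ⟨g⟩ := nonempty_algHom_algebraicClosure K (iteratedIntegers f ⧸ Q)
  refine ⟨⟨g.toRingHom.comp (Ideal.Quotient.mk Q), fun p => ?_⟩⟩
  rw [RingHom.comp_apply, key]
  exact g.commutes _

end Existence

end IteratedMonodromy

end

/-! Elements of `σ.field` lie in any field that contains the backward orbit of t₀, and good
reduction of φ outside S makes that orbit unramified.

Let Ω/F be the iterated extension and B the integral closure of K[t] in Ω. Two homomorphisms B → K̄
that agree on K[t] differ by an element of Gal(Ω/F) on each finite family
(`exists_forall_eq_galRestrict`); finite families suffice, so no compactness argument is needed.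
Normality of `σ.field` follows. If τ fixes the backward orbit of t₀, write τ∘σ = σ∘g on y ∈ B and on
the finitely many roots that generate y. As t₀ is not post-critical, σ is injective on each fibre,
so g fixes these roots, hence y, and τ fixes σ(y) (`GlobalSpecialization.field_le`).

Let V be a valuation ring of K̄ above a finite place outside S. At a point x with φ^n(x) = t₀ the
derivative of φ^n is, up to units, a product of differences y − r with r critical and y in the
forward orbit of x. Each of them divides some t₀ − ν with ν post-critical, so it is a unit
(`valuation_derivative_iter`), and the different of K(x)/K is prime to the place
(`isUnramifiedAt_of_iter_eq`). -/

namespace IteratedMonodromy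

/-! ### Conjugacy of specializations under the Galois group. -/

section Conjugation

/-- If two ring homomorphisms to a field of characteristic zero are conjugate at each element, then
they are conjugate, by a single group element, on each finite family of elements. -/
theorem exists_forall_eq_smul {B L G : Type*} [CommRing B] [Field L] [CharZero L] [Group G]
    [MulSemiringAction G B] (σ σ' : B →+* L) (h : ∀ z, ∃ g : G, σ' z = σ (g • z)) {n : ℕ}
    (x : Fin n → B) (hfin : ∀ i, (MulAction.orbit G (x i)).Finite) :
    ∃ g : G, ∀ i, σ' (x i) = σ (g • x i) := by
  -- Conjugacy of single elements is applied to a one-parameter family of combinations. The orbits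
  -- being finite, one tuple of conjugates serves infinitely many c, and a polynomial in c with
  -- infinitely many zeros vanishes coefficientwise.
  choose g hg using fun c : ℕ => h (∑ i : Fin n, (c : B) ^ (i : ℕ) * x i)
  have (i : Fin n) : Finite (MulAction.orbit G (x i)) := hfin i
  let f : ℕ → (∀ i, MulAction.orbit G (x i)) := fun c i => ⟨g c • x i, MulAction.mem_orbit _ _⟩
  obtain ⟨y, hy⟩ := Finite.exists_infinite_fiber f
  obtain ⟨⟨c₀, hc₀⟩⟩ := hy.nonempty
  refine ⟨g c₀, ?_⟩
  let q : L[X] := ∑ i : Fin n, C (σ' (x i) - σ (g c₀ • x i)) * X ^ (i : ℕ)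
  have hroot : ∀ c ∈ f ⁻¹' {y}, q.IsRoot (c : L) := by
    intro c hc
    have hcc : ∀ i, g c • x i = g c₀ • x i := fun i =>
      congrArg Subtype.val (congrFun ((hc : f c = y).trans (hc₀ : f c₀ = y).symm) i)
    have := hg c
    simp only [smul_mul', smul_pow', Finset.smul_sum, map_sum, map_mul, map_pow,
      map_natCast, hcc] at this
    have hn : ∀ k : ℕ, ∀ a : G, a • (k : B) = k := fun k a =>
      map_natCast (MulSemiringAction.toRingHom G B a) k
    simp only [hn, map_natCast] at this
    simp only [q, IsRoot.def, eval_finsetSum, eval_mul, eval_C, eval_pow, eval_X, sub_mul,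
      Finset.sum_sub_distrib]
    rw [sub_eq_zero]
    simpa only [mul_comm] using this
  have hq : q = 0 := by
    refine Polynomial.eq_zero_of_infinite_isRoot q
      (Set.Infinite.mono (s := Nat.cast '' (f ⁻¹' {y})) ?_ ?_)
    · rintro _ ⟨c, hc, rfl⟩
      exact hroot c hc
    · exact (Set.infinite_coe_iff.mp hy).image Nat.cast_injective.injOn
  intro i
  have := congrArg (fun p : L[X] => p.coeff (i : ℕ)) hq
  simp only [q, finsetSum_coeff, coeff_C_mul_X_pow, coeff_zero] at this
  rw [Finset.sum_eq_single i] at this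
  · simpa [sub_eq_zero] using this
  · intro j _ hj
    rw [if_neg fun h => hj (Fin.ext h.symm)]
  · simp

variable (A F Ω B : Type*) [CommRing A] [CommRing B] [Algebra A B] [Field F] [Field Ω]
  [Algebra A F] [IsFractionRing A F] [Algebra F Ω] [Algebra A Ω] [IsScalarTower A F Ω]
  [Algebra B Ω] [IsScalarTower A B Ω] [IsIntegralClosure B A Ω] [IsDomain A]
  [IsIntegrallyClosed A] [Normal F Ω]

/-- In the AKLB setup with `Ω` normal over `F`, two homomorphisms from `B` to a field which agree
on `A` are conjugate at each element of `B`. -/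
theorem exists_eq_galRestrict {L : Type*} [Field L] (σ σ' : B →+* L)
    (h : σ.comp (algebraMap A B) = σ'.comp (algebraMap A B)) (z : B) :
    ∃ g : Gal(Ω/F), σ' z = σ (galRestrict A F Ω B g z) := by
  have hinj : Function.Injective (algebraMap B Ω) := IsIntegralClosure.algebraMap_injective B A Ω
  have : IsDomain B := hinj.isDomain _
  have hz : IsIntegral A z := IsIntegralClosure.isIntegral A Ω z
  have hmin : minpoly F (algebraMap B Ω z) = (minpoly A z).map (algebraMap A F) :=
    minpoly.isIntegrallyClosed_eq_field_fractions F Ω hz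
  have hmap : ((minpoly A z).map (algebraMap A B)).map (algebraMap B Ω) =
      (minpoly F (algebraMap B Ω z)).map (algebraMap F Ω) := by
    rw [hmin, Polynomial.map_map, Polynomial.map_map, ← IsScalarTower.algebraMap_eq,
      ← IsScalarTower.algebraMap_eq]
  have hmon : ((minpoly A z).map (algebraMap A B)).Monic := (minpoly.monic hz).map _
  have hroots : ∀ a ∈ (((minpoly A z).map (algebraMap A B)).map (algebraMap B Ω)).roots,
      ∃ g : Gal(Ω/F), algebraMap B Ω (galRestrict A F Ω B g z) = a := by
    intro a ha
    rw [hmap] at ha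
    have ha' := (mem_roots'.mp ha).2
    rw [IsRoot.def, eval_map_algebraMap] at ha'
    obtain ⟨g, hg⟩ := minpoly.exists_algEquiv_of_root'
      (Algebra.IsAlgebraic.isAlgebraic (algebraMap B Ω z)) ha'
    exact ⟨g, by rw [algebraMap_galRestrict_apply, hg]⟩
  -- The roots in Ω are Galois conjugates of z and so already lie in B. The factorization can
  -- therefore be pushed through σ, and σ' z is the image of one of the roots.
  have hsplit : ((minpoly A z).map (algebraMap A B)).Splits := by
    refine Splits.of_splits_map_of_injective hinj ?_ fun a ha => ?_
    · rw [hmap]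
      exact Normal.splits inferInstance _
    · obtain ⟨g, rfl⟩ := hroots a ha
      exact ⟨_, rfl⟩
  have h0 : (((minpoly A z).map (algebraMap A B)).map σ).eval (σ' z) = 0 := by
    rw [Polynomial.map_map, h, ← Polynomial.map_map, eval_map_apply, eval_map_algebraMap,
      minpoly.aeval, map_zero]
  rw [hsplit.eq_prod_roots_of_monic hmon, Polynomial.map_multiset_prod, eval_multiset_prod,
    Multiset.prod_eq_zero_iff] at h0
  simp only [Multiset.map_map, Multiset.mem_map, Function.comp_apply, Polynomial.map_sub, map_X,
    map_C, eval_sub, eval_X, eval_C, sub_eq_zero] at h0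
  obtain ⟨b, hb, hσ⟩ := h0
  obtain ⟨g, hg⟩ := hroots (algebraMap B Ω b) <| by
    rw [mem_roots (hmon.map _).ne_zero, IsRoot.def, eval_map_apply, (isRoot_of_mem_roots hb).eq_zero,
      map_zero]
  exact ⟨g, by rw [hσ, hinj hg]⟩

/-- In the AKLB setup with `Ω` normal over `F`, two homomorphisms from `B` to a field of
characteristic zero which agree on `A` are conjugate on each finite family of elements. -/
theorem exists_forall_eq_galRestrict {L : Type*} [Field L] [CharZero L] (σ σ' : B →+* L)
    (h : σ.comp (algebraMap A B) = σ'.comp (algebraMap A B)) {n : ℕ} (x : Fin n → B) :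
    ∃ g : Gal(Ω/F), ∀ i, σ' (x i) = σ (galRestrict A F Ω B g (x i)) := by
  have hinj : Function.Injective (algebraMap B Ω) := IsIntegralClosure.algebraMap_injective B A Ω
  have : IsDomain B := hinj.isDomain _
  let _ : MulSemiringAction Gal(Ω/F) B := IsIntegralClosure.MulSemiringAction A F Ω B
  refine exists_forall_eq_smul σ σ' (exists_eq_galRestrict A F Ω B σ σ' h) x fun i => ?_
  have hz : IsIntegral A (x i) := IsIntegralClosure.isIntegral A Ω (x i)
  refine ((minpoly A (x i)).rootSet_finite B).subset ?_
  rintro _ ⟨g, rfl⟩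
  rw [mem_rootSet']
  refine ⟨((minpoly.monic hz).map _).ne_zero, ?_⟩
  change aeval (galRestrict A F Ω B g (x i)) _ = 0
  rw [aeval_algHom_apply, minpoly.aeval, map_zero]

end Conjugation

/-! ### Iterates and their derivatives. -/

section Iterates

theorem iter_zero {k : Type*} [Field k] (f : k[X]) : iter f 0 = X := rfl

theorem iter_succ {k : Type*} [Field k] (f : k[X]) (n : ℕ) : iter f (n + 1) = f.comp (iter f n) :=
  Function.iterate_succ_apply' _ _ _

theorem iter_succ' {k : Type*} [Field k] (f : k[X]) (n : ℕ) :
    iter f (n + 1) = (iter f n).comp f := by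
  induction n with
  | zero => simp [iter_succ, iter_zero]
  | succ n ih => rw [iter_succ, ih, ← comp_assoc, ← iter_succ, ih]

theorem eval_iter {k : Type*} [Field k] (f : k[X]) (n : ℕ) (x : k) :
    (iter f n).eval x = (fun z => f.eval z)^[n] x := by
  rw [iter, iterate_comp_eval, eval_X]

theorem map_iter {k L : Type*} [Field k] [Field L] (i : k →+* L) (f : k[X]) (n : ℕ) :
    (iter f n).map i = iter (f.map i) n := by
  induction n with
  | zero => simp [iter_zero]
  | succ n ih => rw [iter_succ, iter_succ, Polynomial.map_comp, ih]

theorem natDegree_iter {k : Type*} [Field k] (f : k[X]) (n : ℕ) :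
    (iter f n).natDegree = f.natDegree ^ n := by
  rw [iter, natDegree_iterate_comp, natDegree_X, mul_one]

/-- The iterates of `f` are separable over a point outside the post-critical set. -/
theorem eval_derivative_iter_ne_zero {L : Type*} [Field L] (f : L[X]) (n : ℕ) (x : L)
    (hx : (iter f n).eval x ∉ postCriticalSet f) : (derivative (iter f n)).eval x ≠ 0 := by
  induction n generalizing x with
  | zero => simp [iter_zero]
  | succ n ih =>
    rw [iter_succ', derivative_comp, eval_mul, eval_comp]
    refine mul_ne_zero (fun h => hx ⟨x, h, n + 1, eval_iter _ _ _⟩) (ih _ ?_)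
    rwa [iter_succ', eval_comp] at hx

end Iterates

/-- The leading coefficient times x is always integral, and here that coefficient can be inverted.
Positive degree ensures that subtracting y leaves it unchanged. -/
theorem isIntegral_of_aeval_eq {R S : Type*} [CommRing R] [CommRing S] [Algebra R S] (p : R[X])
    (hu : IsUnit p.leadingCoeff) (hp : 0 < p.natDegree) (y : R) {x : S}
    (h : aeval x p = algebraMap R S y) : IsIntegral R x := by
  have hlc : (p - C y).leadingCoeff = p.leadingCoeff :=
    leadingCoeff_sub_of_degree_lt (degree_C_le.trans_lt (natDegree_pos_iff_degree_pos.mp hp))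
  have := isIntegral_leadingCoeff_smul (p - C y) x (by rw [map_sub, h, aeval_C, sub_self])
  rw [hlc] at this
  obtain ⟨u, hu⟩ := hu
  rw [← hu] at this
  simpa [smul_smul] using this.smul (↑u⁻¹ : R)

/-! ### The specialized field and the backward orbit of t₀. -/

section SpecializedField

variable {K : Type*} [Field K]

/-- A root of `p(x) - t` is integral over `K[t]`. -/
theorem isIntegral_of_eval₂_eq {R : Type*} [CommRing R] [Algebra K[X] R] (p : K[X])
    (hp : 0 < p.natDegree) (x : R)
    (hx : p.eval₂ ((algebraMap K[X] R).comp C) x = algebraMap K[X] R X) : IsIntegral K[X] x := by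
  refine isIntegral_of_aeval_eq (p.map C) ?_ ?_ X (by rwa [aeval_def, eval₂_map])
  · rw [leadingCoeff_map_of_injective C_injective, isUnit_C, isUnit_iff_ne_zero]
    exact leadingCoeff_ne_zero.mpr (by rintro rfl; simp at hp)
  · rwa [natDegree_map_eq_of_injective C_injective]

variable {f : K[X]} {t₀ : K}

theorem mem_rootSet_Phi_iff (hf : 0 < f.natDegree) {Ω : Type*} [Field Ω] [Algebra (RatFunc K) Ω]
    (n : ℕ) (x : Ω) : x ∈ (Phi f n).rootSet Ω ↔
      (iter f n).eval₂ ((algebraMap (RatFunc K) Ω).comp (algebraMap K (RatFunc K))) x =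
        algebraMap (RatFunc K) Ω RatFunc.X := by
  have h0 : Phi f n ≠ 0 := by
    intro h
    have := congrArg natDegree h
    rw [Phi, natDegree_sub_C, natDegree_map, natDegree_iter, natDegree_zero] at this
    exact (pow_pos hf n).ne' this
  rw [mem_rootSet_of_ne h0, Phi, map_sub, aeval_C, aeval_def, eval₂_map, sub_eq_zero]

theorem isIntegral_of_mem_rootSet_Phi (hf : 0 < f.natDegree) (n : ℕ) (x : iteratedField f)
    (hx : x ∈ (Phi f n).rootSet (iteratedField f)) : IsIntegral K[X] x := by
  rw [mem_rootSet_Phi_iff hf] at hx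
  refine isIntegral_of_eval₂_eq (iter f n) (by rw [natDegree_iter]; positivity) x ?_
  rw [IsScalarTower.algebraMap_eq K[X] (RatFunc K), RingHom.comp_apply, RatFunc.algebraMap_X, ← hx]
  congr 1

instance : Normal (RatFunc K) (iteratedField f) := by
  unfold iteratedField
  rw [IntermediateField.adjoin_iUnion]
  refine @IntermediateField.normal_iSup _ _ _ _ _ _ _ fun n => ?_
  exact Normal.of_isSplittingField (hFEp := IntermediateField.adjoin_rootSet_isSplittingField
    (IsAlgClosed.splits _)) (Phi f n)

theorem GlobalSpecialization.eval₂_eq (σ : GlobalSpecialization f t₀) (p : K[X])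
    (x : iteratedIntegers f)
    (hx : p.eval₂ ((algebraMap K[X] (iteratedIntegers f)).comp C) x =
      algebraMap K[X] (iteratedIntegers f) X) :
    (p.map (algebraMap K (AlgebraicClosure K))).eval (σ.toRingHom x) =
      algebraMap K (AlgebraicClosure K) t₀ := by
  have := congrArg σ.toRingHom hx
  rw [σ.map_polynomial, hom_eval₂, eval_X] at this
  rw [eval_map, ← this]
  congr 1
  ext a
  simp [σ.map_polynomial]

/-- A specialization is injective on the fibres of a polynomial which is separable over `t₀`. -/
theorem GlobalSpecialization.eq_of_eval₂_eq (σ : GlobalSpecialization f t₀) (p : K[X])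
    (x y : iteratedIntegers f)
    (hx : p.eval₂ ((algebraMap K[X] (iteratedIntegers f)).comp C) x =
      algebraMap K[X] (iteratedIntegers f) X)
    (hy : p.eval₂ ((algebraMap K[X] (iteratedIntegers f)).comp C) y =
      algebraMap K[X] (iteratedIntegers f) X)
    (hxy : σ.toRingHom x = σ.toRingHom y)
    (hsep : (derivative (p.map (algebraMap K (AlgebraicClosure K)))).eval (σ.toRingHom x) ≠ 0) :
    x = y := by
  by_contra hne
  let P : (iteratedIntegers f)[X] := p.map ((algebraMap K[X] (iteratedIntegers f)).comp C) -
    C (algebraMap K[X] (iteratedIntegers f) X)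
  have hPx : P.IsRoot x := by simp [P, IsRoot.def, eval_map, hx]
  have hPy : P.eval y = 0 := by simp [P, eval_map, hy]
  obtain ⟨h, hh⟩ := dvd_iff_isRoot.mpr hPx
  have hhy : h.eval y = 0 := by
    rw [hh, eval_mul, eval_sub, eval_X, eval_C] at hPy
    exact (mul_eq_zero.mp hPy).resolve_left (sub_ne_zero.mpr (Ne.symm hne))
  -- Differentiating P = (X − x)h at σ(x) = σ(y) leaves h(σ(y)) = 0: two roots that merge under σ
  -- would give a double root.
  have hd := congrArg (fun q => (derivative (q.map σ.toRingHom)).eval (σ.toRingHom x)) hh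
  simp only [Polynomial.map_mul, Polynomial.map_sub, map_X, map_C, derivative_mul, derivative_sub,
    derivative_X, derivative_C, eval_add, eval_mul, eval_sub, eval_X, eval_C, sub_self, zero_mul,
    add_zero, sub_zero, one_mul] at hd
  rw [hxy, eval_map_apply, hhy, map_zero, ← hxy] at hd
  apply hsep
  have hmap : (p.map ((algebraMap K[X] (iteratedIntegers f)).comp C)).map σ.toRingHom =
      p.map (algebraMap K (AlgebraicClosure K)) := by
    rw [Polynomial.map_map]
    congr 1
    ext a
    simp [σ.map_polynomial]
  rwa [Polynomial.map_sub, map_C, derivative_sub, derivative_C, sub_zero, hmap] at hd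

variable [CharZero K]

/-- A specialization is determined up to the Galois group of the iterated extension on each finite
family of elements. -/
theorem GlobalSpecialization.exists_conj (σ : GlobalSpecialization f t₀)
    (τ : AlgebraicClosure K →ₐ[K] AlgebraicClosure K) {n : ℕ} (x : Fin n → iteratedIntegers f) :
    ∃ g : Gal(iteratedField f/RatFunc K), ∀ i, τ (σ.toRingHom (x i)) =
      σ.toRingHom (galRestrict K[X] (RatFunc K) (iteratedField f) (iteratedIntegers f) g (x i)) := by
  refine exists_forall_eq_galRestrict K[X] (RatFunc K) (iteratedField f) (iteratedIntegers f)
    σ.toRingHom ((τ : AlgebraicClosure K →+* AlgebraicClosure K).comp σ.toRingHom) ?_ x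
  refine RingHom.ext fun p => ?_
  simp only [RingHom.comp_apply, σ.map_polynomial]
  exact (τ.commutes _).symm

theorem GlobalSpecialization.normal_field (σ : GlobalSpecialization f t₀) :
    Normal K σ.field := by
  rw [IntermediateField.normal_iff_forall_map_le]
  rintro τ _ ⟨_, ⟨y, rfl⟩, rfl⟩
  obtain ⟨g, hg⟩ := σ.exists_conj τ ![y]
  exact ⟨_, (hg 0).symm⟩

/-- Outside the post-critical set, the specialized field is generated by the roots of the
polynomials `φ^{∘ n}(x) - t₀`. -/
theorem GlobalSpecialization.field_le (σ : GlobalSpecialization f t₀) (hf : 0 < f.natDegree)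
    (ht₀ : algebraMap K (AlgebraicClosure K) t₀ ∉
      postCriticalSet (f.map (algebraMap K (AlgebraicClosure K))))
    {M : IntermediateField K (AlgebraicClosure K)}
    (hM : ∀ n, ∀ α : AlgebraicClosure K, (iter (f.map (algebraMap K (AlgebraicClosure K))) n).eval α
      = algebraMap K (AlgebraicClosure K) t₀ → α ∈ M) : σ.field ≤ M := by
  rintro _ ⟨y, rfl⟩
  -- By Galois theory it is enough that every τ fixing M fixes σ(y).
  rw [← InfiniteGalois.fixedField_fixingSubgroup M, IntermediateField.mem_fixedField_iff]
  intro τ hτ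
  obtain ⟨T, hT, hyT⟩ := IntermediateField.exists_finset_of_mem_adjoin
    (S := ⋃ n : ℕ, (Phi f n).rootSet (AlgebraicClosure (RatFunc K))) (y : iteratedField f).2
  have hB : ∀ a ∈ T, ∃ (b : iteratedIntegers f) (n : ℕ),
      ((b : iteratedField f) : AlgebraicClosure (RatFunc K)) = a ∧
      (iter f n).eval₂ ((algebraMap K[X] (iteratedIntegers f)).comp C) b =
        algebraMap K[X] (iteratedIntegers f) X := by
    intro a ha
    obtain ⟨n, hn⟩ := Set.mem_iUnion.mp (hT ha)
    have haΩ : a ∈ iteratedField f := IntermediateField.subset_adjoin _ _ (hT ha)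
    have hΩ : (⟨a, haΩ⟩ : iteratedField f) ∈ (Phi f n).rootSet (iteratedField f) := by
      rw [mem_rootSet] at hn ⊢
      refine ⟨hn.1, Subtype.ext (Eq.trans ?_ hn.2)⟩
      exact (aeval_algebraMap_apply (AlgebraicClosure (RatFunc K)) (⟨a, haΩ⟩ : iteratedField f) _).symm
    refine ⟨⟨⟨a, haΩ⟩, isIntegral_of_mem_rootSet_Phi hf n _ hΩ⟩, n, rfl, ?_⟩
    rw [mem_rootSet_Phi_iff hf] at hΩ
    apply Subtype.ext
    refine Eq.trans ?_ (hΩ.trans ?_)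
    · exact hom_eval₂ _ _ (iteratedIntegers f).val.toRingHom _
    · rw [← RatFunc.algebraMap_X]
      rfl
  choose b n hb hbn using fun a : T => hB a a.2
  -- One g must serve y (index 0) and all the roots in T at once; this is why conjugacy is needed
  -- for families.
  obtain ⟨g, hg⟩ := σ.exists_conj (τ : AlgebraicClosure K →ₐ[K] AlgebraicClosure K)
    (Fin.cons y fun i => b (T.equivFin.symm i))
  have hgy := hg 0
  have hgb : ∀ a : T, galRestrict K[X] (RatFunc K) (iteratedField f) (iteratedIntegers f) g (b a)
      = b a := by
    intro a
    have h1 := hg (T.equivFin a).succ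
    simp only [Fin.cons_succ, Equiv.symm_apply_apply] at h1
    have hroot := σ.eval₂_eq _ _ (hbn a)
    have hfix : τ (σ.toRingHom (b a)) = σ.toRingHom (b a) :=
      hτ ⟨_, hM (n a) _ (by rwa [map_iter] at hroot)⟩
    refine (σ.eq_of_eval₂_eq _ _ _ (hbn a) ?_ (hfix.symm.trans h1) ?_).symm
    · have := congrArg
        (galRestrict K[X] (RatFunc K) (iteratedField f) (iteratedIntegers f) g) (hbn a)
      rw [AlgEquiv.commutes] at this
      rw [← this]
      symm
      refine (hom_eval₂ _ _ (galRestrict K[X] (RatFunc K) (iteratedField f) (iteratedIntegers f)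
        g : iteratedIntegers f →+* iteratedIntegers f) _).trans ?_
      congr 1
      ext c
      simp
    · rw [map_iter] at hroot ⊢
      exact eval_derivative_iter_ne_zero _ _ _ (hroot ▸ ht₀)
  have hgy' : galRestrict K[X] (RatFunc K) (iteratedField f) (iteratedIntegers f) g y = y := by
    apply Subtype.ext
    apply Subtype.ext
    -- The field generated by T sits in the algebraic closure of F, so g is first lifted there.
    have key : ∀ z ∈ IntermediateField.adjoin (RatFunc K) (T : Set (AlgebraicClosure (RatFunc K))),
        g.liftNormal (AlgebraicClosure (RatFunc K)) z = z := by
      intro z hz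
      induction hz using IntermediateField.adjoin_induction with
      | mem a ha =>
        have h1 := g.liftNormal_commutes (AlgebraicClosure (RatFunc K)) (b ⟨a, ha⟩ : iteratedField f)
        have h2 := algebraMap_galRestrict_apply K[X] g (b ⟨a, ha⟩)
        rw [hgb] at h2
        have h3 : _ = a := hb ⟨a, ha⟩
        rw [← h3]
        exact h1.trans (congrArg _ h2.symm)
      | algebraMap a => exact AlgEquiv.commutes _ _
      | add a c _ _ ha hc => rw [map_add, ha, hc]
      | inv a _ ha => rw [map_inv₀, ha]
      | mul a c _ _ ha hc => rw [map_mul, ha, hc]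
    have h1 := g.liftNormal_commutes (AlgebraicClosure (RatFunc K)) (y : iteratedField f)
    have h2 := algebraMap_galRestrict_apply K[X] g y
    exact (congrArg (algebraMap (iteratedField f) (AlgebraicClosure (RatFunc K))) h2).trans
      (h1.symm.trans (key _ hyT))
  exact hgy.trans (congrArg _ hgy')

end SpecializedField

/-! ### Good reduction at a valuation ring. -/

section ValuationSubring

variable {L : Type*} [Field L] (V : ValuationSubring L)

theorem mem_valuationSubring_of_eval_mem (p : V[X]) (hu : IsUnit p.leadingCoeff)
    (hp : 0 < p.natDegree) {x : L} (hx : (p.map V.subtype).eval x ∈ V) : x ∈ V := by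
  have h : IsIntegral V x := by
    refine isIntegral_of_aeval_eq p hu hp ⟨_, hx⟩ ?_
    rw [aeval_def, eval₂_eq_eval_map]
    rfl
  obtain ⟨y, rfl⟩ := IsIntegrallyClosed.isIntegral_iff.mp h
  exact y.2

theorem valuation_eval_sub_le (p : V[X]) {x y : L} (hx : x ∈ V) (hy : y ∈ V) :
    V.valuation ((p.map V.subtype).eval x - (p.map V.subtype).eval y) ≤ V.valuation (x - y) := by
  obtain ⟨q, hq⟩ := sub_dvd_eval_sub (⟨x, hx⟩ : V) ⟨y, hy⟩ p
  have h := congrArg V.subtype hq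
  rw [map_mul, map_sub, map_sub, ← eval_map_apply, ← eval_map_apply] at h
  have h' : (p.map V.subtype).eval x - (p.map V.subtype).eval y = (x - y) * (q : L) := h
  rw [h', map_mul]
  exact mul_le_of_le_one_right' (V.valuation_le_one q)

theorem exists_map_eq_iter (p : V[X]) (n : ℕ) :
    ∃ q : V[X], q.map V.subtype = iter (p.map V.subtype) n := by
  induction n with
  | zero => exact ⟨X, map_X _⟩
  | succ n ih =>
    obtain ⟨q, hq⟩ := ih
    exact ⟨p.comp q, by rw [Polynomial.map_comp, hq, iter_succ]⟩

variable [IsAlgClosed L] [CharZero L]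

/-- Good reduction: if the leading coefficient and the degree of `p` are units at `V`, and `t` is
not congruent to a post-critical point, then the points of the backward orbit of `t` are integral at
`V`, and the iterates of `p` are unramified at them modulo the maximal ideal. -/
theorem valuation_derivative_iter (p : V[X]) (hu : IsUnit p.leadingCoeff)
    (hd : IsUnit (p.natDegree : V)) (h1 : 1 < p.natDegree) (t : L)
    (ht : ∀ ν ∈ postCriticalSet (p.map V.subtype), V.valuation (t - ν) = 1) :
    t ∈ V ∧ ∀ n x, (iter (p.map V.subtype) n).eval x = t →
      x ∈ V ∧ V.valuation ((derivative (iter (p.map V.subtype) n)).eval x) = 1 := by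
  have hchar : CharZero V := ⟨fun a b h => by simpa using congrArg V.subtype h⟩
  have hu' : IsUnit (derivative p).leadingCoeff := by
    rw [leadingCoeff_derivative]
    exact hu.mul hd
  have hd' : 0 < (derivative p).natDegree := by
    rw [natDegree_derivative]
    omega
  have hcrit : ∀ r ∈ criticalPoints (p.map V.subtype), r ∈ V := by
    intro r hr
    refine mem_valuationSubring_of_eval_mem V (derivative p) hu' hd' ?_
    rw [← derivative_map, show eval r (derivative (p.map V.subtype)) = 0 from hr]
    exact V.zero_mem
  have hsplit : (derivative (p.map V.subtype)).Splits := IsAlgClosed.splits _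
  have hinj : Function.Injective V.subtype := V.subtype_injective
  have htV : t ∈ V := by
    -- As the degree exceeds 1 there is a critical point r. It is integral, and t − r is a unit, so
    -- t is integral.
    obtain ⟨r, hr⟩ := hsplit.exists_eval_eq_zero (by
      rw [derivative_map, degree_map_eq_of_injective hinj]
      exact (natDegree_pos_iff_degree_pos.mp hd').ne')
    have h := ht r ⟨r, hr, 0, rfl⟩
    have h2 : t - r ∈ V := V.mem_of_valuation_le_one _ h.le
    simpa using V.add_mem _ _ h2 (hcrit r hr)
  refine ⟨htV, fun n => ?_⟩
  induction n with
  | zero =>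
    intro x hx
    rw [iter_zero, eval_X] at hx
    exact ⟨hx ▸ htV, by simp [iter_zero]⟩
  | succ n ih =>
    intro x hx
    have hx' := hx
    rw [iter_succ', eval_comp] at hx'
    obtain ⟨hy, hval⟩ := ih _ hx'
    have hxV : x ∈ V := mem_valuationSubring_of_eval_mem V p hu (by omega) hy
    refine ⟨hxV, ?_⟩
    rw [iter_succ', derivative_comp, eval_mul, eval_comp, map_mul, hval, mul_one,
      hsplit.eval_eq_prod_roots, map_mul, map_multiset_prod, derivative_map,
      leadingCoeff_map_of_injective hinj]
    have hlc : V.valuation (V.subtype (derivative p).leadingCoeff) = 1 :=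
      (V.valuation_eq_one_iff _).mp hu'
    rw [hlc, one_mul]
    refine Multiset.prod_eq_one fun a ha => ?_
    simp only [Multiset.map_map, Multiset.mem_map, Function.comp_apply] at ha
    obtain ⟨r, hr, rfl⟩ := ha
    rw [← derivative_map] at hr
    have hrc : r ∈ criticalPoints (p.map V.subtype) := (isRoot_of_mem_roots hr).eq_zero
    have hrV := hcrit r hrc
    refine le_antisymm ((V.valuation_le_one_iff _).mpr (sub_mem hxV hrV)) ?_
    -- In V, x − r divides the difference of the (n+1)-st iterates at x and r, which is t − ν with ν
    -- post-critical, hence a unit.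
    obtain ⟨q, hq⟩ := exists_map_eq_iter V p (n + 1)
    have h := valuation_eval_sub_le V q hxV hrV
    rwa [hq, hx, ht _ ⟨r, hrc, n + 1, eval_iter _ _ _⟩] at h

end ValuationSubring

/-! ### Valuation rings of K̄ centred at a given prime. -/

section Domination

/-- Chevalley's extension theorem, transported to the image of `i`. It turns a prime of `𝓞 E` into a
place of K̄. -/
theorem exists_valuationSubring_of_ideal {R L : Type*} [CommRing R] [Field L] (i : R →+* L)
    (hi : Function.Injective i) (P : Ideal R) (hP : P ≠ ⊤) :
    ∃ V : ValuationSubring L, (∀ a, i a ∈ V) ∧ ∀ a ∈ P, V.valuation (i a) < 1 := by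
  let e : R ≃+* i.range := RingEquiv.ofBijective i.rangeRestrict
    ⟨fun a b h => hi (congrArg Subtype.val h), i.rangeRestrict_surjective⟩
  obtain ⟨V, hV, hPV⟩ := Ideal.image_subset_nonunits_valuationSubring
    (P.comap (e.symm : i.range →+* R)) (Ideal.comap_ne_top _ hP)
  refine ⟨V, fun a => hV ⟨a, rfl⟩, fun a ha => V.mem_nonunits_iff.mp (hPV ⟨e a, ?_, rfl⟩)⟩
  simpa using ha

variable {K : Type*} [Field K] [NumberField K]

theorem valuation_algebraMap_eq_one {V : ValuationSubring (AlgebraicClosure K)}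
    {v : HeightOneSpectrum (𝓞 K)}
    (hV : ∀ a : 𝓞 K, algebraMap (𝓞 K) (AlgebraicClosure K) a ∈ V)
    (hv : ∀ a ∈ v.asIdeal, V.valuation (algebraMap (𝓞 K) (AlgebraicClosure K) a) < 1)
    {a : 𝓞 K} (ha : a ∉ v.asIdeal) :
    V.valuation (algebraMap (𝓞 K) (AlgebraicClosure K) a) = 1 := by
  refine le_antisymm ((V.valuation_le_one_iff _).mpr (hV a)) (not_lt.mp fun hlt => ?_)
  obtain ⟨y, i, hi, h⟩ := v.isMaximal.exists_inv ha
  have h1 : V.valuation (algebraMap (𝓞 K) (AlgebraicClosure K) (y * a + i)) < 1 := by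
    rw [map_add, map_mul]
    refine V.valuation.map_add_lt ?_ (hv i hi)
    rw [map_mul]
    exact (mul_le_of_le_one_left' ((V.valuation_le_one_iff _).mpr (hV y))).trans_lt hlt
  rw [h] at h1
  simp at h1

/-- A valuation ring which is centred at the prime `v` extends `v`. -/
theorem extendsPlace_of_valuation_lt_one {V : ValuationSubring (AlgebraicClosure K)}
    {v : HeightOneSpectrum (𝓞 K)}
    (hV : ∀ a : 𝓞 K, algebraMap (𝓞 K) (AlgebraicClosure K) a ∈ V)
    (hv : ∀ a ∈ v.asIdeal, V.valuation (algebraMap (𝓞 K) (AlgebraicClosure K) a) < 1) :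
    ExtendsPlace v V := by
  rw [ExtendsPlace, ← HeightOneSpectrum.valuationSubringAtPrime_eq_valuationSubring]
  symm
  -- The valuation ring of v is discrete, so the only valuation ring strictly above it is the whole
  -- field.
  refine ValuationSubring.eq_of_le_of_ne_top _ ?_ ?_
  · rw [HeightOneSpectrum.valuationSubringAtPrime_eq_valuationSubring]
    intro x hx
    obtain ⟨m, d, h⟩ := v.exists_primeCompl_mul_eq_of_integer x hx
    have h2 := congrArg (fun z => V.valuation (algebraMap K (AlgebraicClosure K) z)) h
    simp only [map_mul, ← IsScalarTower.algebraMap_apply] at h2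
    rw [valuation_algebraMap_eq_one hV hv d.2, mul_one] at h2
    rw [ValuationSubring.mem_comap, ← V.valuation_le_one_iff, h2]
    exact (V.valuation_le_one_iff _).mpr (hV m)
  · intro htop
    obtain ⟨a, ha, ha0⟩ := Submodule.exists_mem_ne_zero_of_ne_bot v.ne_bot
    have h1 : (algebraMap (𝓞 K) K a)⁻¹ ∈ V.comap (algebraMap K (AlgebraicClosure K)) := by
      rw [htop]
      exact ValuationSubring.mem_top _
    rw [ValuationSubring.mem_comap, ← V.valuation_le_one_iff, map_inv₀, map_inv₀,
      ← IsScalarTower.algebraMap_apply] at h1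
    have h0 : V.valuation (algebraMap (𝓞 K) (AlgebraicClosure K) a) ≠ 0 := by
      rw [_root_.map_ne_zero]
      exact (map_ne_zero_iff _ (FaithfulSMul.algebraMap_injective (𝓞 K) (AlgebraicClosure K))).mpr ha0
    exact absurd (hv a ha) (not_lt.mpr ((inv_le_one₀ (zero_lt_iff.mpr h0)).mp h1))

end Domination

/-! ### From unit derivatives to unramified primes. -/

section Unramified

theorem exists_leadingCoeff_iterate_comp {R : Type*} [CommRing R] [IsDomain R] (p : R[X])
    (hp : p.natDegree ≠ 0) (n : ℕ) : ∃ k, (p.comp^[n] X).leadingCoeff = p.leadingCoeff ^ k := by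
  induction n with
  | zero => exact ⟨0, by simp⟩
  | succ n ih =>
    obtain ⟨k, hk⟩ := ih
    refine ⟨1 + k * p.natDegree, ?_⟩
    rw [Function.iterate_succ_apply', leadingCoeff_comp, hk, pow_add, pow_one, pow_mul]
    rw [natDegree_iterate_comp, natDegree_X, mul_one]
    exact pow_ne_zero _ hp

theorem map_iterate_comp {R k : Type*} [CommRing R] [Field k] (i : R →+* k) (p : R[X]) (n : ℕ) :
    (p.comp^[n] X).map i = iter (p.map i) n := by
  induction n with
  | zero => simp [iter_zero]
  | succ n ih => rw [Function.iterate_succ_apply', Polynomial.map_comp, ih, iter_succ]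

/-- Chain rule for the identity obtained by substituting cX into the scaled polynomial. If c is a
unit at a place, scaling preserves unit derivatives there. -/
theorem eval_derivative_scaleRoots {R : Type*} [CommRing R] (p : R[X]) (c x : R) :
    (derivative (p.scaleRoots c)).eval (c * x) * c = c ^ p.natDegree * (derivative p).eval x := by
  have h : (p.scaleRoots c).comp (C c * X) = C (c ^ p.natDegree) * p := by
    rw [comp, scaleRoots_eval₂_mul, C_pow, ← comp, comp_X]
  have h2 := congrArg (fun q => (derivative q).eval x) h
  simp only [derivative_comp, derivative_mul, derivative_C, derivative_X, zero_mul, zero_add,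
    mul_one, eval_mul, eval_C, eval_comp, eval_X] at h2
  rw [← h2, mul_comm]

variable {K : Type*} [Field K]

theorem geometric_eq (φ : (𝓞 K)[X]) :
    geometric φ = φ.map (algebraMap (𝓞 K) (AlgebraicClosure K)) := by
  rw [geometric, Polynomial.map_map, ← IsScalarTower.algebraMap_eq]

variable [NumberField K]

/-- The derivative of the minimal polynomial at an integral generator lies in the different, and
ramified primes contain the different. -/
theorem isUnramifiedAt_of_aeval_derivative_notMem {E : Type*} [Field E] [NumberField E]
    [Algebra K E] (P : Ideal (𝓞 E)) [P.IsPrime] (β : 𝓞 E)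
    (hβ : Algebra.adjoin K {algebraMap (𝓞 E) E β} = ⊤)
    (h : aeval β (derivative (minpoly (𝓞 K) β)) ∉ P) : Algebra.IsUnramifiedAt (𝓞 K) P := by
  let _ := FractionRing.liftAlgebra (𝓞 K) (FractionRing (𝓞 E))
  have : CharZero (FractionRing (𝓞 K)) := charZero_of_injective_algebraMap
    (FaithfulSMul.algebraMap_injective (𝓞 K) (FractionRing (𝓞 K)))
  have : Algebra.IsAlgebraic (FractionRing (𝓞 K)) (FractionRing (𝓞 E)) :=
    isAlgebraic_of_isFractionRing (𝓞 K) (𝓞 E) _ _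
  rw [← not_dvd_differentIdeal_iff, Ideal.dvd_iff_le]
  exact fun hle => h (hle (aeval_derivative_mem_differentIdeal (𝓞 K) K E β hβ))

/-- Outside the ramification set, the points of the backward orbit of `t₀` generate unramified
extensions. -/
theorem isUnramifiedAt_of_iter_eq (φ : (𝓞 K)[X]) (hdeg : 1 < φ.natDegree) (t₀ : K)
    (v : HeightOneSpectrum (𝓞 K)) (hv : Sum.inl v ∉ ramificationSet φ t₀) (n : ℕ)
    {E : Type*} [Field E] [NumberField E] [Algebra K E] [Algebra E (AlgebraicClosure K)]
    [IsScalarTower K E (AlgebraicClosure K)] (γ : E) (hγ : Algebra.adjoin K {γ} = ⊤)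
    (hα : (iter (geometric φ) n).eval (algebraMap E (AlgebraicClosure K) γ) =
      algebraMap K (AlgebraicClosure K) t₀) (P : Ideal (𝓞 E)) [P.IsPrime] [P.LiesOver v.asIdeal] :
    Algebra.IsUnramifiedAt (𝓞 K) P := by
  set α := algebraMap E (AlgebraicClosure K) γ with hαdef
  let i : 𝓞 E →+* AlgebraicClosure K := (algebraMap E (AlgebraicClosure K)).comp
    (algebraMap (𝓞 E) E)
  have hE (a : 𝓞 K) : algebraMap E (AlgebraicClosure K) (algebraMap (𝓞 K) E a) =
      algebraMap (𝓞 K) (AlgebraicClosure K) a := by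
    rw [IsScalarTower.algebraMap_apply (𝓞 K) K E, ← IsScalarTower.algebraMap_apply K E,
      ← IsScalarTower.algebraMap_apply]
  have hiK (a : 𝓞 K) : i (algebraMap (𝓞 K) (𝓞 E) a) = algebraMap (𝓞 K) (AlgebraicClosure K) a := by
    rw [RingHom.comp_apply, ← IsScalarTower.algebraMap_apply (𝓞 K) (𝓞 E) E, hE]
  have hi : Function.Injective i := (algebraMap E _).injective.comp
    (FaithfulSMul.algebraMap_injective _ _)
  obtain ⟨V, hiV, hPV⟩ := exists_valuationSubring_of_ideal i hi P
    (Ideal.IsPrime.ne_top inferInstance)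
  have hV : ∀ a : 𝓞 K, algebraMap (𝓞 K) (AlgebraicClosure K) a ∈ V := fun a => hiK a ▸ hiV _
  have hvV : ∀ a ∈ v.asIdeal, V.valuation (algebraMap (𝓞 K) (AlgebraicClosure K) a) < 1 :=
    fun a ha => hiK a ▸ hPV _ ((Ideal.mem_of_liesOver P v.asIdeal a).mp ha)
  have hext : ExtendsPlace v V := extendsPlace_of_valuation_lt_one hV hvV
  let j : 𝓞 K →+* V := (algebraMap (𝓞 K) (AlgebraicClosure K)).codRestrict V hV
  have hj (p : (𝓞 K)[X]) : (p.map j).map V.subtype =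
      p.map (algebraMap (𝓞 K) (AlgebraicClosure K)) := by
    rw [Polynomial.map_map]
    rfl
  have hinj : Function.Injective (algebraMap (𝓞 K) (AlgebraicClosure K)) :=
    FaithfulSMul.algebraMap_injective _ _
  have hjinj : Function.Injective j := fun a b h => hinj (congrArg V.subtype h)
  have hS : (∀ A, ExtendsPlace v A → A.valuation (φ.natDegree : AlgebraicClosure K) = 1) ∧
      (∀ A, ExtendsPlace v A → A.valuation (geometric φ).leadingCoeff = 1) ∧
      ∀ ν ∈ postCriticalSet (geometric φ), ∀ A, ExtendsPlace v A →
        A.valuation (algebraMap K (AlgebraicClosure K) t₀ - ν) = 1 := by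
    have : ¬ (_ ∨ _ ∨ _) := hv
    push Not at this
    simp only [NonvanishingOn] at this
    push Not at this
    exact this
  obtain ⟨hSd, hSa, hSν⟩ := hS
  have hlc : V.valuation (algebraMap (𝓞 K) (AlgebraicClosure K) φ.leadingCoeff) = 1 := by
    have := hSa V hext
    rwa [geometric_eq, leadingCoeff_map_of_injective hinj] at this
  rw [geometric_eq] at hα hSν
  obtain ⟨ht, hgood⟩ := valuation_derivative_iter V (φ.map j)
    (by
      rw [leadingCoeff_map_of_injective hjinj]
      exact (V.valuation_eq_one_iff _).mpr hlc)
    (by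
      rw [natDegree_map_eq_of_injective hjinj]
      refine (V.valuation_eq_one_iff _).mpr ?_
      exact_mod_cast hSd V hext)
    (by rwa [natDegree_map_eq_of_injective hjinj]) (algebraMap K (AlgebraicClosure K) t₀)
    (by
      rw [hj]
      exact fun ν hν => hSν ν hν V hext)
  rw [hj] at hgood
  obtain ⟨-, hα'⟩ := hgood n α hα
  have htv : v.valuation K t₀ ≤ 1 := by
    rw [← Valuation.mem_valuationSubring_iff, ← hext]
    exact ht
  obtain ⟨m, d, hmd⟩ := v.exists_primeCompl_mul_eq_of_integer t₀ htv
  have hd1 := valuation_algebraMap_eq_one hV hvV d.2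
  have hd0 : (d : 𝓞 K) ≠ 0 := by
    intro h
    simp [h] at hd1
  -- With t₀ = m/d and d prime to v, this clears the denominator of φ^n(x) − t₀ by a unit at V.
  let Q : (𝓞 K)[X] := C (d : 𝓞 K) * φ.comp^[n] X - C m
  have hQmap : Q.map (algebraMap (𝓞 K) (AlgebraicClosure K)) =
      C (algebraMap (𝓞 K) (AlgebraicClosure K) d) *
        iter (φ.map (algebraMap (𝓞 K) (AlgebraicClosure K))) n -
      C (algebraMap (𝓞 K) (AlgebraicClosure K) m) := by
    simp only [Q, Polynomial.map_sub, Polynomial.map_mul, map_C, map_iterate_comp]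
  have hQα : (Q.map (algebraMap (𝓞 K) (AlgebraicClosure K))).eval α = 0 := by
    rw [hQmap, eval_sub, eval_mul, eval_C, eval_C, hα, sub_eq_zero, mul_comm,
      IsScalarTower.algebraMap_apply (𝓞 K) K (AlgebraicClosure K) d, ← map_mul, hmd,
      ← IsScalarTower.algebraMap_apply]
  have hQ' : V.valuation ((derivative (Q.map (algebraMap (𝓞 K) (AlgebraicClosure K)))).eval α)
      = 1 := by
    rw [hQmap, derivative_sub, derivative_C, sub_zero, derivative_C_mul, eval_mul, eval_C, map_mul,
      hd1, hα', one_mul]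
  have hc : V.valuation (algebraMap (𝓞 K) (AlgebraicClosure K) Q.leadingCoeff) = 1 := by
    obtain ⟨k, hk⟩ := exists_leadingCoeff_iterate_comp φ (by omega) n
    have hlt : (C m).degree < (C (d : 𝓞 K) * φ.comp^[n] X).degree := by
      rw [degree_C_mul hd0]
      refine degree_C_le.trans_lt (natDegree_pos_iff_degree_pos.mp ?_)
      rw [natDegree_iterate_comp, natDegree_X, mul_one]
      exact pow_pos (by omega) n
    rw [leadingCoeff_sub_of_degree_lt hlt, leadingCoeff_mul, leadingCoeff_C, hk, map_mul, map_pow,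
      map_mul, map_pow, hd1, hlc, one_pow, one_mul]
  set c := Q.leadingCoeff with hcdef
  have hc0 : c ≠ 0 := by
    intro h
    simp [h] at hc
  have hgen : aeval γ Q = 0 := by
    apply (algebraMap E (AlgebraicClosure K)).injective
    rw [aeval_def, hom_eval₂, map_zero, ← hαdef, RingHom.ext (f := RingHom.comp _ _) hE, ← eval_map,
      hQα]
  -- γ need not be integral at other places; β = cγ is, and generates the same field.
  let β : 𝓞 E := IsIntegralClosure.mk' (𝓞 E) _ (isIntegral_leadingCoeff_smul Q _ hgen)
  have hβ : algebraMap (𝓞 E) E β = c • γ :=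
    IsIntegralClosure.algebraMap_mk' _ _ _
  have hiβ : i β = algebraMap (𝓞 K) (AlgebraicClosure K) c * α := by
    rw [RingHom.comp_apply, hβ, Algebra.smul_def, map_mul, hE]
  have haeval (p : (𝓞 K)[X]) : i (aeval β p) =
      (p.map (algebraMap (𝓞 K) (AlgebraicClosure K))).eval (i β) := by
    rw [aeval_def, hom_eval₂, eval_map]
    congr 1
    exact RingHom.ext hiK
  refine isUnramifiedAt_of_aeval_derivative_notMem P β ?_ fun hmem => ?_
  · rw [eq_top_iff, ← hγ, Algebra.adjoin_le_iff, Set.singleton_subset_iff, hβ]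
    have h := Subalgebra.smul_mem _ (Algebra.subset_adjoin (R := K)
      (Set.mem_singleton (c • γ))) ((algebraMap (𝓞 K) K c)⁻¹)
    rwa [← algebraMap_smul K c γ, smul_smul, inv_mul_cancel₀, one_smul] at h
    exact (map_ne_zero_iff _ (FaithfulSMul.algebraMap_injective (𝓞 K) K)).mpr hc0
  · have hlt := hPV _ hmem
    have hHβ : aeval β (Q.scaleRoots c) = 0 := by
      apply hi
      rw [haeval, hiβ, map_zero, eval_map, scaleRoots_eval₂_mul, ← eval_map, hQα, mul_zero]
    -- The derivative of the minimal polynomial at β therefore divides that of the scaled Q, which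
    -- is a unit at V.
    obtain ⟨q, hq⟩ := minpoly.isIntegrallyClosed_dvd (Algebra.IsIntegral.isIntegral β) hHβ
    have hder := congrArg (fun p => i (aeval β (derivative p))) hq
    simp only [derivative_mul, map_add, map_mul, minpoly.aeval, zero_mul, add_zero] at hder
    have hqV : V.valuation (i (aeval β q)) ≤ 1 := (V.valuation_le_one_iff _).mpr (hiV _)
    have h1 : V.valuation (i (aeval β (derivative (Q.scaleRoots c)))) = 1 := by
      have h2 := eval_derivative_scaleRoots (Q.map (algebraMap (𝓞 K) (AlgebraicClosure K)))
        (algebraMap (𝓞 K) (AlgebraicClosure K) c) α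
      rw [← map_scaleRoots _ _ _ (by
        rw [← hcdef]
        exact (map_ne_zero_iff _ hinj).mpr hc0), derivative_map, ← hiβ, ← haeval] at h2
      have h3 := congrArg V.valuation h2
      rwa [map_mul, map_mul, map_pow, hc, hQ', one_pow, mul_one, mul_one] at h3
    rw [hder, map_mul] at h1
    exact absurd h1 ((mul_le_of_le_one_right' hqV).trans_lt hlt).ne

end Unramified

/-! ### Restriction homomorphisms between Galois groups. -/

section Restriction

/-- Restriction of automorphisms between two normal subextensions, as the unique continuous map
compatible with the restrictions from the ambient Galois extension. -/
theorem existsUnique_restriction {k Ω : Type*} [Field k] [Field Ω] [Algebra k Ω] [IsGalois k Ω]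
    (M N : IntermediateField k Ω) [Normal k M] [Normal k N] (h : M ≤ N) :
    ∃! ρ : Gal(N/k) →ₜ* Gal(M/k), Function.Surjective ρ ∧
      ∀ g : Gal(Ω/k), ρ (AlgEquiv.restrictNormalHom N g) = AlgEquiv.restrictNormalHom M g := by
  have hN : Function.Surjective (AlgEquiv.restrictNormalHom (F := k) (K₁ := Ω) N) :=
    AlgEquiv.restrictNormalHom_surjective Ω
  have hM : Function.Surjective (AlgEquiv.restrictNormalHom (F := k) (K₁ := Ω) M) :=
    AlgEquiv.restrictNormalHom_surjective Ω
  have hker : (AlgEquiv.restrictNormalHom (F := k) (K₁ := Ω) N).ker ≤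
      (AlgEquiv.restrictNormalHom (F := k) (K₁ := Ω) M).ker := by
    rw [IntermediateField.restrictNormalHom_ker, IntermediateField.restrictNormalHom_ker]
    exact IntermediateField.fixingSubgroup_antitone h
  let ρ : Gal(N/k) →* Gal(M/k) := MonoidHom.liftOfSurjective _ hN ⟨_, hker⟩
  have hρ (g : Gal(Ω/k)) :
      ρ (AlgEquiv.restrictNormalHom N g) = AlgEquiv.restrictNormalHom M g :=
    MonoidHom.liftOfRightInverse_comp_apply _ _ _ ⟨_, hker⟩ g
  have hcont : Continuous ρ := by
    -- A continuous surjection from a compact to a Hausdorff space is a quotient map, so continuity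
    -- can be tested on Gal(Ω/k).
    rw [(Topology.IsQuotientMap.of_surjective_continuous hN
      (InfiniteGalois.restrictNormalHom_continuous N)).continuous_iff]
    exact (InfiniteGalois.restrictNormalHom_continuous M).congr fun g => (hρ g).symm
  refine ⟨⟨ρ, hcont⟩, ⟨fun x => ?_, hρ⟩, fun ρ' h' => ?_⟩
  · obtain ⟨g, rfl⟩ := hM x
    exact ⟨_, hρ g⟩
  · ext1 x
    obtain ⟨g, rfl⟩ := hN x
    exact (h'.2 g).trans (hρ g).symm

end Restriction

/-! ### The field K_S: normality and the backward orbit. -/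

section Unramified

variable {K : Type*} [Field K] [NumberField K]

/-- Being unramified passes to subextensions. -/
theorem isUnramifiedIn_of_algHom {E₁ E₂ : Type*} [Field E₁] [NumberField E₁] [Algebra K E₁]
    [Field E₂] [NumberField E₂] [Algebra K E₂] (e : E₁ →ₐ[K] E₂) (p : Ideal (𝓞 K))
    (h : Algebra.IsUnramifiedIn (𝓞 E₂) p) : Algebra.IsUnramifiedIn (𝓞 E₁) p := by
  intro P hP hPp
  let _ : Algebra (𝓞 E₁) (𝓞 E₂) := (RingOfIntegers.mapAlgHom e).toRingHom.toAlgebra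
  have : IsScalarTower (𝓞 K) (𝓞 E₁) (𝓞 E₂) :=
    .of_algebraMap_eq fun a => ((RingOfIntegers.mapAlgHom e).commutes a).symm
  have hinj : Function.Injective (algebraMap (𝓞 E₁) (𝓞 E₂)) := by
    intro a b hab
    exact RingOfIntegers.ext (e.injective (congrArg (algebraMap (𝓞 E₂) E₂) hab))
  have : FaithfulSMul (𝓞 E₁) (𝓞 E₂) := (faithfulSMul_iff_algebraMap_injective _ _).mpr hinj
  have : Algebra.IsIntegral (𝓞 E₁) (𝓞 E₂) := Algebra.IsIntegral.tower_top (𝓞 K)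
  obtain ⟨Q, -, hQ, hQP⟩ := Ideal.exists_ideal_over_prime_of_isIntegral P (⊥ : Ideal (𝓞 E₂))
    (by rw [Ideal.comap_bot_of_injective _ hinj]; exact bot_le)
  have hQP' : Q.LiesOver P := ⟨hQP.symm⟩
  have := h Q hQ (Ideal.LiesOver.trans Q P p)
  exact Algebra.IsUnramifiedAt.of_liesOver (𝓞 K) P Q

theorem isUnramifiedAtPlace_map {L : IntermediateField K (AlgebraicClosure K)} {v : Place K}
    (h : IsUnramifiedAtPlace L v) (e : AlgebraicClosure K ≃ₐ[K] AlgebraicClosure K) :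
    IsUnramifiedAtPlace (L.map (e : AlgebraicClosure K →ₐ[K] AlgebraicClosure K)) v := by
  cases v with
  | inl v =>
    intro E hE hfin
    let e' : E ≃ₐ[K] E.map (e.symm : AlgebraicClosure K →ₐ[K] AlgebraicClosure K) :=
      IntermediateField.intermediateFieldMap e.symm E
    have hfin' : FiniteDimensional K (E.map (e.symm : AlgebraicClosure K →ₐ[K] AlgebraicClosure K)) :=
      Module.Finite.equiv e'.toLinearEquiv
    have : NumberField E := .of_module_finite K E
    have : NumberField (E.map (e.symm : AlgebraicClosure K →ₐ[K] AlgebraicClosure K)) :=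
      .of_module_finite K _
    refine isUnramifiedIn_of_algHom e'.toAlgHom _ (h _ ?_ hfin')
    rintro _ ⟨x, hx, rfl⟩
    obtain ⟨y, hy, rfl⟩ := hE hx
    simpa using hy
  | inr w =>
    intro v' hv'
    rw [InfinitePlace.isUnramified_iff, hv']
    let e' : L ≃ₐ[K] L.map (e : AlgebraicClosure K →ₐ[K] AlgebraicClosure K) :=
      IntermediateField.intermediateFieldMap e L
    have h1 := h (v'.comap (e' : L →+* _)) (by
      rw [← hv', ← InfinitePlace.comap_comp]
      congr 1
      exact RingHom.ext fun a => e'.commutes a)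
    rw [InfinitePlace.isUnramified_iff] at h1
    refine h1.imp (fun h2 => ?_) (fun h2 => ?_)
    · exact (InfinitePlace.isReal_comap_iff (e' : L ≃+* _)).mp h2
    · rw [← InfinitePlace.comap_comp] at h2
      rw [← hv']
      convert h2 using 2
      exact RingHom.ext fun a => (e'.commutes a).symm

/-- Automorphisms of K̄ over K permute the extensions whose compositum is K_S. -/
theorem normal_maxUnramifiedOutside (S : Set (Place K)) :
    Normal K (maxUnramifiedOutside S) := by
  rw [IntermediateField.normal_iff_forall_map_le]
  intro τ
  obtain ⟨e, rfl⟩ : ∃ e : AlgebraicClosure K ≃ₐ[K] AlgebraicClosure K, (e : _ →ₐ[K] _) = τ :=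
    ⟨AlgEquiv.ofBijective τ (Algebra.IsAlgebraic.algHom_bijective τ), AlgHom.ext fun _ => rfl⟩
  rw [IntermediateField.map_le_iff_le_comap]
  refine sSup_le fun L hL => ?_
  rw [← IntermediateField.map_le_iff_le_comap]
  exact le_sSup fun v hv => isUnramifiedAtPlace_map (hL v hv) e

open IntermediateField in
/-- The points of the backward orbit of `t₀` lie in `K_S`. -/
theorem mem_maxUnramifiedOutside_of_iter_eq (φ : (𝓞 K)[X]) (hdeg : 1 < φ.natDegree) (t₀ : K) (n : ℕ)
    (α : AlgebraicClosure K)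
    (hα : (iter (geometric φ) n).eval α = algebraMap K (AlgebraicClosure K) t₀) :
    α ∈ maxUnramifiedOutside (ramificationSet φ t₀) := by
  refine (le_sSup (?_ : K⟮α⟯ ∈ _) : K⟮α⟯ ≤ _) (mem_adjoin_simple_self K α)
  have hαK : IsIntegral K α := Algebra.IsIntegral.isIntegral α
  have : FiniteDimensional K K⟮α⟯ := adjoin.finiteDimensional hαK
  have : NumberField K⟮α⟯ := .of_module_finite K _
  rintro (v | w) hv
  · intro E hE hfin
    have : NumberField E := .of_module_finite K E
    refine isUnramifiedIn_of_algHom (IntermediateField.inclusion hE) _ fun P hP hPv => ?_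
    refine isUnramifiedAt_of_iter_eq φ hdeg t₀ v hv n (AdjoinSimple.gen K α) ?_ ?_ P
    · rw [← adjoin.powerBasis_gen hαK]
      exact (adjoin.powerBasis hαK).adjoin_gen_eq_top
    · rwa [AdjoinSimple.algebraMap_gen]
  · intro v' hv'
    rw [InfinitePlace.isUnramified_iff, hv']
    -- S contains all real places, so w is complex and cannot ramify.
    exact Or.inr (InfinitePlace.not_isReal_iff_isComplex.mp hv)

end Unramified

/-! ### Finiteness of S. -/

section Finiteness

theorem finite_postCriticalSet {L : Type*} [Field L] [CharZero L] (f : L[X])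
    (hf : 0 < f.natDegree) (h : IsPostCriticallyFinite f) : (postCriticalSet f).Finite := by
  have hd : derivative f ≠ 0 := by
    intro h0
    have := derivative_eq_zero.mp h0
    omega
  have hcrit : (criticalPoints f).Finite := finite_setOfPred_isRoot hd
  refine (hcrit.biUnion (t := fun r => Set.range fun n : ℕ => (fun z => f.eval z)^[n] r)
    fun r hr => ?_).subset ?_
  · obtain ⟨m, p, hp, hper⟩ := h r hr
    refine ((Set.finite_lt_nat (m + p)).image fun n => (fun z => f.eval z)^[n] r).subset ?_
    rintro _ ⟨n, rfl⟩
    rcases lt_or_ge n m with hn | hn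
    · exact ⟨n, by simp only [Set.mem_ofPred_eq]; omega, rfl⟩
    · obtain ⟨q, rfl⟩ := Nat.exists_eq_add_of_le' hn
      -- After the preperiod m only the residue mod p matters, so m + p iterates exhaust the orbit.
      refine ⟨q % p + m, by have := Nat.mod_lt q hp; simp only [Set.mem_ofPred_eq]; omega, ?_⟩
      simp only [Function.iterate_add_apply]
      exact hper.iterate_mod_apply q
  · rintro _ ⟨r, hr, n, rfl⟩
    exact Set.mem_biUnion hr ⟨n, rfl⟩

variable {K : Type*} [Field K] [NumberField K]

/-- Some nonzero multiple cα is integral over `𝓞 K`, and c is invertible away from its prime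
divisors. Applied to α and α⁻¹ it makes α a unit at almost all places. -/
theorem exists_mem_of_extendsPlace (α : AlgebraicClosure K) :
    ∃ c : 𝓞 K, c ≠ 0 ∧ ∀ v : HeightOneSpectrum (𝓞 K), c ∉ v.asIdeal → ∀ A, ExtendsPlace v A →
      α ∈ A := by
  have halg : IsAlgebraic (𝓞 K) α :=
    (IsFractionRing.isAlgebraic_iff (𝓞 K) K (AlgebraicClosure K)).mpr
      (Algebra.IsAlgebraic.isAlgebraic α)
  obtain ⟨c, hc, hint⟩ := halg.exists_integral_multiple
  refine ⟨c, hc, fun v hv A hA => ?_⟩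
  have hmem (x : K) : algebraMap K (AlgebraicClosure K) x ∈ A ↔ v.valuation K x ≤ 1 := by
    rw [← ValuationSubring.mem_comap, hA, Valuation.mem_valuationSubring_iff]
  let j : 𝓞 K →+* A := (algebraMap (𝓞 K) (AlgebraicClosure K)).codRestrict A fun a => by
    rw [IsScalarTower.algebraMap_apply (𝓞 K) K, hmem]
    exact v.valuation_le_one a
  have hint' : IsIntegral A (c • α) :=
    hint.map_of_comp_eq (φ := j) (ψ := RingHom.id (AlgebraicClosure K)) rfl
  obtain ⟨y, hy⟩ := IsIntegrallyClosed.isIntegral_iff.mp hint'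
  have hinv : algebraMap K (AlgebraicClosure K) (algebraMap (𝓞 K) K c)⁻¹ ∈ A := by
    rw [hmem, map_inv₀, v.valuation_eq_one_iff_notMem.mpr hv, inv_one]
  have h := A.mul_mem _ _ hinv y.2
  have hy' : (y : AlgebraicClosure K) = algebraMap (𝓞 K) (AlgebraicClosure K) c * α :=
    hy.trans (Algebra.smul_def c α)
  rw [hy', IsScalarTower.algebraMap_apply (𝓞 K) K (AlgebraicClosure K) c, ← mul_assoc, ← map_mul,
    inv_mul_cancel₀, map_one, one_mul] at h
  · exact h
  · exact (map_ne_zero_iff _ (FaithfulSMul.algebraMap_injective (𝓞 K) K)).mpr hc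

/-- A nonzero algebraic number is a unit at almost all places. -/
theorem finite_setOf_nonvanishingOn (α : AlgebraicClosure K) (hα : α ≠ 0) :
    {v : HeightOneSpectrum (𝓞 K) | NonvanishingOn v α}.Finite := by
  have hfin (c : 𝓞 K) (hc : c ≠ 0) : {v : HeightOneSpectrum (𝓞 K) | c ∈ v.asIdeal}.Finite := by
    refine (Ideal.finite_factors (I := Ideal.span {c}) (by simpa using hc)).subset fun v hv => ?_
    exact Ideal.dvd_span_singleton.mpr hv
  obtain ⟨c, hc, h⟩ := exists_mem_of_extendsPlace α
  obtain ⟨c', hc', h'⟩ := exists_mem_of_extendsPlace α⁻¹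
  refine ((hfin c hc).union (hfin c' hc')).subset ?_
  rintro v ⟨A, hA, hne⟩
  by_contra hv
  rw [Set.mem_union, not_or] at hv
  have h1 := (A.valuation_le_one_iff _).mpr (h v hv.1 A hA)
  have h2 := (A.valuation_le_one_iff _).mpr (h' v hv.2 A hA)
  rw [map_inv₀, inv_le_one₀ (zero_lt_iff.mpr ((_root_.map_ne_zero _).mpr hα))] at h2
  exact hne (le_antisymm h1 h2)

theorem finite_ramificationSet (φ : (𝓞 K)[X]) (hdeg : 1 < φ.natDegree)
    (hpcf : IsPostCriticallyFinite (geometric φ)) (t₀ : K)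
    (ht₀ : algebraMap K (AlgebraicClosure K) t₀ ∉ postCriticalSet (geometric φ)) :
    (ramificationSet φ t₀).Finite := by
  have hnd : (geometric φ).natDegree = φ.natDegree := by
    rw [geometric_eq, natDegree_map_eq_of_injective (FaithfulSMul.algebraMap_injective _ _)]
  have h1 := finite_setOf_nonvanishingOn (K := K) (φ.natDegree : AlgebraicClosure K)
    (Nat.cast_ne_zero.mpr (by omega))
  have h2 := finite_setOf_nonvanishingOn (geometric φ).leadingCoeff
    (leadingCoeff_ne_zero.mpr (by rintro h; rw [h, natDegree_zero] at hnd; omega))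
  have h3 := (finite_postCriticalSet (geometric φ) (by omega) hpcf).biUnion fun ν hν =>
    finite_setOf_nonvanishingOn (algebraMap K (AlgebraicClosure K) t₀ - ν)
      (sub_ne_zero.mpr fun h => ht₀ (h ▸ hν))
  refine (((h1.union (h2.union h3)).image Sum.inl).union
    ((Set.finite_univ (α := InfinitePlace K)).image Sum.inr)).subset ?_
  rintro (v | w) h
  · refine Or.inl ⟨v, ?_, rfl⟩
    refine Or.imp id (Or.imp id ?_) h
    rintro ⟨ν, hν, hv⟩
    exact Set.mem_biUnion hν hv
  · exact Or.inr ⟨w, trivial, rfl⟩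

end Finiteness

end IteratedMonodromy

open IteratedMonodromy in
theorem mainTheorem5 (K : Type*) [Field K] [NumberField K] (φ : (𝓞 K)[X])
    (hdeg : 1 < φ.natDegree) (hpcf : IsPostCriticallyFinite (geometric φ))
    (t₀ : K) (ht₀ : algebraMap K (AlgebraicClosure K) t₀ ∉ postCriticalSet (geometric φ))
    (σ : GlobalSpecialization (φ.map (algebraMap (𝓞 K) K)) t₀) :
    (ramificationSet φ t₀).Finite ∧
    ∃ (_ : IsGalois K (maxUnramifiedOutside (ramificationSet φ t₀))) (_ : IsGalois K σ.field),
      σ.field ≤ maxUnramifiedOutside (ramificationSet φ t₀) ∧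
      ∃! ρ : Gal(maxUnramifiedOutside (ramificationSet φ t₀)/K) →ₜ* Gal(σ.field/K),
        Function.Surjective ρ ∧
        ∀ g : Gal(AlgebraicClosure K/K),
          ρ (AlgEquiv.restrictNormalHom (maxUnramifiedOutside (ramificationSet φ t₀)) g) =
            AlgEquiv.restrictNormalHom σ.field g := by
  have := σ.normal_field
  have := normal_maxUnramifiedOutside (ramificationSet φ t₀)
  have hle : σ.field ≤ maxUnramifiedOutside (ramificationSet φ t₀) := by
    refine σ.field_le ?_ ht₀ fun n α hα => mem_maxUnramifiedOutside_of_iter_eq φ hdeg t₀ n α hα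
    rw [natDegree_map_eq_of_injective (FaithfulSMul.algebraMap_injective (𝓞 K) K)]
    omega
  -- Each `⟨⟩` combines normality, now available as an instance, with separability in characteristic
  -- zero.
  exact ⟨finite_ramificationSet φ hdeg hpcf t₀ ht₀, ⟨⟩, ⟨⟩, hle, existsUnique_restriction _ _ hle⟩
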